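/- Let $\mathbb K$ be a finite field with $q$ elements, $n\ge 0$, and let $U_n=U_n(\mathbb K)$ be the group of $n\times n$ upper triangular matrices over $\mathbb K$ with ones on the diagonal. For a set partition $\pi\vdash[n]$, an arc of $\pi$ is a pair $(i,j)$, $i<j$, of elements of one block with no element of that block strictly between them; $D(\pi)$ is the set of arcs. A pair $(i,j)$ with $i<j$ is $\pi$-regular if there is no $k<i$ with $(k,j)\in D(\pi)$ and no $l>j$ with $(i,l)\in D(\pi)$, and $\pi$-singular otherwise. Let $\mathcal J_\pi\subseteq U_n$ be the set of matrices $A$ with $A_{i,j}\neq 0$ for $(i,j)\in D(\pi)$, $A_{i,j}=0$ for every $\pi$-regular pair $(i,j)\notin D(\pi)$, and arbitrary entries at the $\pi$-singular pairs. Fix a nontrivial additive character $\psi:\mathbb K\to\mathbb C^\times$. Let $\mathfrak u_n$ be the space of strictly upper triangular matrices. For $\varphi:D(\pi)\to\mathbb K^\times$ let $\lambda_{\pi,\varphi}\in\mathfrak u_n^*$ be $x\mapsto\sum_{(i,j)\in D(\pi)}\varphi(i,j)x_{i,j}$, let $\mathcal O_{\pi,\varphi}$ be the set of functionals $x\mapsto\lambda_{\pi,\varphi}(gxh)$,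 $g,h\in U_n$, and $\mathcal R_{\pi,\varphi}$ the subset of those with $g=1$. The supercharacter of $U_n$ indexed by $\pi$ is $$\chi^\pi(u)=\sum_{\varphi:D(\pi)\to\mathbb K^\times}\frac{|\mathcal R_{\pi,\varphi}|}{|\mathcal O_{\pi,\varphi}|}\sum_{\mu\in\mathcal O_{\pi,\varphi}}\psi(\mu(u-1)),\qquad u\in U_n,$$ and the superplancherel measure of $\pi$ is $$\mathrm{SPl}(\pi)=\frac1{|U_n|}\,\frac{\chi^\pi(1)^2}{\langle\chi^\pi,\chi^\pi\rangle},\qquad \langle\chi,\xi\rangle=\frac1{|U_n|}\sum_{u\in U_n}\chi(u)\overline{\xi(u)}.$$ Consider the following algorithm with input $A\in U_n$. Set $A^0=A$. For $k=1,\dots,n$, obtain $A^k$ from $A^{k-1}$ as follows: for every nonzero entry $A^{k-1}_{i,n-k+i}$ ($1\le i\le k$) of the $k$-th diagonal counted from the upper right corner, replace that entry by $1$, and replace by $0$ all entries to its left in row $i$ and below it in column $n-k+i$, up to (and excluding) the main diagonal; leave all other entries unchanged. Let $\tilde A=A^n$, and let $\pi(A)$ be the set partition of $[n]$ whose blocks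 are the connected components of the graph on $[n]$ with an edge $\{i,j\}$ for every nonzero entry $\tilde A_{i,j}$, $i<j$. Then: 1. The sets $\mathcal J_\pi$, $\pi\vdash[n]$, are nonempty, pairwise distinct and form a partition of $U_n$. 2. For every $\pi\vdash[n]$, $\mathrm{SPl}(\pi)=|\mathcal J_\pi|/|U_n|$. Equivalently, $\mathrm{SPl}(\pi)$ is the probability that a uniformly random matrix in $U_n$ belongs to $\mathcal J_\pi$. 3. For every $A\in U_n$, $A\in\mathcal J_{\pi(A)}$; the arcs of $\pi(A)$ are exactly the positions above the diagonal of the nonzero entries of $\tilde A$; and $\tilde A$ is the canonical matrix of $\pi(A)$, that is, $\tilde A_{i,j}=1$ if $i=j$ or $(i,j)\in D(\pi(A))$, and $\tilde A_{i,j}=0$ otherwise. 4. If $A$ is uniformly random in $U_n$, then $\pi(A)$ is distributed according to the superplancherel measure: $\mathbb P(\pi(A)=\pi)=\mathrm{SPl}(\pi)$ for every $\pi\vdash[n]$. -/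

import Mathlib

open scoped BigOperators

/-! ### Set partitions and their arcs -/

/-- The pairs `(i, j)`, `i < j`, of consecutive elements of a common block of the set partition
`π` of an `n`-element linearly ordered set. -/
def arcs {n : ℕ} (π : Finpartition (Finset.univ : Finset (Fin n))) : Set (Fin n × Fin n) :=
  {p | p.1 < p.2 ∧ ∃ B ∈ π.parts, p.1 ∈ B ∧ p.2 ∈ B ∧ ∀ k ∈ B, ¬(p.1 < k ∧ k < p.2)}

/-- The `π`-regular pairs: no arc ends at `j` starting before `i`, and no arc starts at `i`
ending after `j`. The other pairs `i < j` are the `π`-singular ones. -/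
def regularPairs {n : ℕ} (π : Finpartition (Finset.univ : Finset (Fin n))) :
    Set (Fin n × Fin n) :=
  {p | p.1 < p.2 ∧ (¬∃ k, k < p.1 ∧ (k, p.2) ∈ arcs π) ∧ ¬∃ l, p.2 < l ∧ (p.1, l) ∈ arcs π}

/-! ### The group of upper unitriangular matrices -/

/-- `U_n(K)`: the upper triangular matrices with all diagonal entries equal to `1`. -/
def unitriangular (n : ℕ) (K : Type*) [Field K] : Subgroup (GL (Fin n) K) where
  carrier := {g | (∀ i, (g : Matrix (Fin n) (Fin n) K) i i = 1) ∧
    ∀ i j, j < i → (g : Matrix (Fin n) (Fin n) K) i j = 0}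
  one_mem' := by
    refine ⟨fun i => by simp, fun i j h => ?_⟩
    simp [Matrix.one_apply_ne h.ne']
  mul_mem' := by
    rintro a b ⟨ha1, ha0⟩ ⟨hb1, hb0⟩
    refine ⟨fun i => ?_, fun i j hij => ?_⟩
    · rw [Units.val_mul, Matrix.mul_apply, Finset.sum_eq_single i]
      · rw [ha1, hb1, one_mul]
      · intro k _ hk
        rcases lt_or_gt_of_ne hk with h | h
        · rw [ha0 i k h, zero_mul]
        · rw [hb0 k i h, mul_zero]
      · simp
    · rw [Units.val_mul, Matrix.mul_apply]
      refine Finset.sum_eq_zero fun k _ => ?_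
      rcases lt_or_ge k i with h | h
      · rw [ha0 i k h, zero_mul]
      · rw [hb0 k j (lt_of_lt_of_le hij h), mul_zero]
  inv_mem' := by
    rintro a ⟨ha1, ha0⟩
    have hb0 : ∀ i j, j < i → ((a⁻¹ : GL (Fin n) K) : Matrix (Fin n) (Fin n) K) i j = 0 := by
      intro i j hij
      have h := Matrix.blockTriangular_inv_of_blockTriangular
        (M := (a : Matrix (Fin n) (Fin n) K)) (b := id) (fun i j hij => ha0 i j hij)
      rw [Matrix.coe_units_inv]
      exact h hij
    refine ⟨fun i => ?_, hb0⟩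
    have h : ((a : Matrix (Fin n) (Fin n) K) *
        ((a⁻¹ : GL (Fin n) K) : Matrix (Fin n) (Fin n) K)) i i = 1 := by
      rw [← Units.val_mul, mul_inv_cancel, Units.val_one, Matrix.one_apply_eq]
    rw [Matrix.mul_apply, Finset.sum_eq_single i] at h
    · rwa [ha1, one_mul] at h
    · intro k _ hk
      rcases lt_or_gt_of_ne hk with h' | h'
      · rw [ha0 i k h', zero_mul]
      · rw [hb0 k i h', mul_zero]
    · simp

/-- The underlying matrix of an element of `U_n(K)`. -/
def uniMatrix {n : ℕ} {K : Type*} [Field K] (g : unitriangular n K) :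
    Matrix (Fin n) (Fin n) K :=
  ((g : GL (Fin n) K) : Matrix (Fin n) (Fin n) K)

noncomputable instance instFintypeUnitriangular (n : ℕ) (K : Type*) [Field K] [Finite K] :
    Fintype (unitriangular n K) :=
  Fintype.ofFinite _

/-! ### The sets `J_π` and canonical matrices -/

/-- The matrices of `U_n(K)` with nonzero entries at the arcs of `π`, zero entries at the other
`π`-regular pairs, and arbitrary entries at the `π`-singular pairs. -/
def Jset {n : ℕ} (K : Type*) [Field K] (π : Finpartition (Finset.univ : Finset (Fin n))) :
    Set (unitriangular n K) :=
  {A | (∀ p ∈ arcs π, uniMatrix A p.1 p.2 ≠ 0) ∧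
    ∀ p ∈ regularPairs π \ arcs π, uniMatrix A p.1 p.2 = 0}

open Classical in
/-- The matrix with entries `1` on the diagonal and at the arcs of `π`, and `0` elsewhere. -/
noncomputable def canonicalMatrix {n : ℕ} (K : Type*) [Field K]
    (π : Finpartition (Finset.univ : Finset (Fin n))) : Matrix (Fin n) (Fin n) K :=
  Matrix.of fun i j => if (i, j) ∈ arcs π ∨ i = j then 1 else 0

/-! ### The reduction algorithm -/

open Classical in
/-- Process the diagonal `{(i, i + d)}` of `A`: each nonzero entry there becomes `1`, and the
entries to its left in its row and below it in its column, up to the main diagonal, become `0`.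
All other entries are unchanged. -/
noncomputable def clearDiagonal {n : ℕ} {K : Type*} [Field K] (d : ℕ)
    (A : Matrix (Fin n) (Fin n) K) : Matrix (Fin n) (Fin n) K :=
  Matrix.of fun i j =>
    if (j : ℕ) = i + d ∧ A i j ≠ 0 then 1
    else if i < j ∧ ((∃ l : Fin n, (l : ℕ) = i + d ∧ j < l ∧ A i l ≠ 0) ∨
        ∃ k : Fin n, (j : ℕ) = k + d ∧ k < i ∧ A k j ≠ 0) then 0
    else A i j

/-- The matrix after `k` steps of the algorithm. The step `k = 1, …, n` processes the `k`-th
diagonal counted from the upper right corner, which has `k` entries `(i, i + (n - k))`. -/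
noncomputable def reduceSteps {n : ℕ} {K : Type*} [Field K] (A : Matrix (Fin n) (Fin n) K) :
    ℕ → Matrix (Fin n) (Fin n) K
  | 0 => A
  | k + 1 => clearDiagonal (n - (k + 1)) (reduceSteps A k)

/-- The output of the algorithm, after its `n` steps. -/
noncomputable def reduceMatrix {n : ℕ} {K : Type*} [Field K] (A : unitriangular n K) :
    Matrix (Fin n) (Fin n) K :=
  reduceSteps (uniMatrix A) n

open Classical in
/-- The set partition read off from the output of the algorithm: its blocks are the connected
components of the graph whose edges are the positions of the nonzero entries of the output. -/
noncomputable def readPartition {n : ℕ} {K : Type*} [Field K] (A : unitriangular n K) :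
    Finpartition (Finset.univ : Finset (Fin n)) :=
  Finpartition.ofSetoid (Relation.EqvGen.setoid fun i j => reduceMatrix A i j ≠ 0)

/-! ### The superplancherel measure -/

/-- The inner product `⟨χ, ξ⟩ = |G|⁻¹ ∑ χ(g) conj(ξ(g))` of functions on a finite group. -/
noncomputable def charInner {G : Type*} [Group G] [Fintype G] (χ ξ : G → ℂ) : ℂ :=
  (Nat.card G : ℂ)⁻¹ * ∑ g : G, χ g * (starRingEnd ℂ) (ξ g)

/-- The superplancherel measure of a supercharacter `χ` of a finite group `G`. -/
noncomputable def superPlancherel {G : Type*} [Group G] [Fintype G] (χ : G → ℂ) : ℂ :=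
  1 / (Nat.card G : ℂ) * (χ 1 ^ 2 / charInner χ χ)

/-! ### The supercharacters of `U_n(K)` indexed by set partitions -/

/-- The space of strictly upper triangular matrices. -/
def strictlyUpper (n : ℕ) (K : Type*) [Field K] : Submodule K (Matrix (Fin n) (Fin n) K) where
  carrier := {x | ∀ i j, j ≤ i → x i j = 0}
  zero_mem' := fun _ _ _ => rfl
  add_mem' := fun {x y} hx hy i j h => by rw [Matrix.add_apply, hx i j h, hy i j h, add_zero]
  smul_mem' := fun c x hx i j h => by rw [Matrix.smul_apply, hx i j h, smul_zero]

/-- The bijection `g ↦ g - 1` from `U_n(K)` to the strictly upper triangular matrices. -/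
def uniSubOne {n : ℕ} {K : Type*} [Field K] (g : unitriangular n K) :
    strictlyUpper n K :=
  ⟨uniMatrix g - 1, fun i j h => by
    rcases h.eq_or_lt with rfl | h
    · rw [Matrix.sub_apply, Matrix.one_apply_eq, uniMatrix, g.2.1, sub_self]
    · rw [Matrix.sub_apply, Matrix.one_apply_ne h.ne', uniMatrix, g.2.2 i j h,
        sub_zero]⟩

open Classical in
/-- For a colouring `φ` of the arcs of `π` by nonzero scalars let `λ(x) = ∑ φ(i, j) x_{ij}`, the
sum over the arcs. This is the translate `x ↦ λ(g x h)` of `λ` by `g, h ∈ U_n(K)`. -/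
noncomputable def arcFunctional {n : ℕ} {K : Type*} [Field K]
    (π : Finpartition (Finset.univ : Finset (Fin n))) (φ : arcs π → Kˣ)
    (g h : unitriangular n K) : Module.Dual K (strictlyUpper n K) where
  toFun x := ∑ p : arcs π,
    (φ p : K) * (uniMatrix g * (x : Matrix (Fin n) (Fin n) K) * uniMatrix h) p.1.1 p.1.2
  map_add' x y := by
    rw [← Finset.sum_add_distrib]
    refine Finset.sum_congr rfl fun p _ => ?_
    rw [Submodule.coe_add, Matrix.mul_add, Matrix.add_mul, Matrix.add_apply, mul_add]
  map_smul' c x := by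
    rw [RingHom.id_apply, smul_eq_mul, Finset.mul_sum]
    refine Finset.sum_congr rfl fun p _ => ?_
    rw [Submodule.coe_smul, Matrix.mul_smul, Matrix.smul_mul, Matrix.smul_apply, smul_eq_mul]
    ring

open Classical in
/-- The orbit of the functional of `(π, φ)` under right translations by `U_n(K)`. -/
noncomputable def rightOrbit {n : ℕ} {K : Type*} [Field K] [Finite K]
    (π : Finpartition (Finset.univ : Finset (Fin n))) (φ : arcs π → Kˣ) :
    Finset (Module.Dual K (strictlyUpper n K)) :=
  Finset.univ.image fun h : unitriangular n K => arcFunctional π φ 1 h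

open Classical in
/-- The orbit of the functional of `(π, φ)` under two-sided translations by `U_n(K)`. -/
noncomputable def twoSidedOrbit {n : ℕ} {K : Type*} [Field K] [Finite K]
    (π : Finpartition (Finset.univ : Finset (Fin n))) (φ : arcs π → Kˣ) :
    Finset (Module.Dual K (strictlyUpper n K)) :=
  Finset.univ.image fun p : unitriangular n K × unitriangular n K => arcFunctional π φ p.1 p.2

/-- The supercharacter of the algebra group `U_n(K)` attached to the coloured set partition
`(π, φ)`, relative to the additive character `ψ` of `K`: with `λ` the functional of `(π, φ)`,
`χ^{π,φ}(g) = |λU| / |UλU| * ∑ μ ∈ UλU, ψ (μ (g - 1))`. -/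
noncomputable def colouredSupercharacter {n : ℕ} {K : Type*} [Field K] [Finite K]
    (ψ : AddChar K ℂ) (π : Finpartition (Finset.univ : Finset (Fin n))) (φ : arcs π → Kˣ)
    (g : unitriangular n K) : ℂ :=
  ((rightOrbit π φ).card : ℂ) / ((twoSidedOrbit π φ).card : ℂ) *
    ∑ μ ∈ twoSidedOrbit π φ, ψ (μ (uniSubOne g))

/-- The supercharacter `χ^π` of `U_n(K)` attached to the set partition `π`: the sum of the
`χ^{π,φ}` over all colourings `φ` of the arcs of `π` by nonzero scalars. -/
noncomputable def supercharacter {n : ℕ} {K : Type*} [Field K] [Finite K]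
    (ψ : AddChar K ℂ) (π : Finpartition (Finset.univ : Finset (Fin n)))
    (g : unitriangular n K) : ℂ :=
  ∑ᶠ φ : arcs π → Kˣ, colouredSupercharacter ψ π φ g

/-! ### Set partitions and their arcs -/

/-! Everything rests on one recursion along diagonals, run from the upper right corner. An output
entry of the algorithm is nonzero exactly when the input entry is nonzero and no nonzero output
entry lies to its right in its row or above it in its column (`reduceMatrix_apply`). The arcs of a
partition `π` with `A ∈ J_π` obey the same recursion, so `A` lies in exactly one `J_π`, the one
found by the algorithm (`mem_Jset_iff_readPartition`).

On the character side, `χ^π` is a constant `c` times the sum of `ψ ∘ μ` over the union `T` of the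
orbits of all colourings. Orthogonality gives `χ(1) = c|T|` and `⟨χ, χ⟩ = c²|T|`, so `c` cancels and
the superplancherel measure is `|T| / |U_n|`. It remains to see that `|T| = |J_π|`, that is, that
each orbit has `q ^ s` elements, with `s` the number of singular pairs.

Only the lower bound is proved directly: explicit translates inject `K ^ s` into the orbit
(`eq_of_arcFunctional_param_eq`). Distinct orbits are disjoint subsets of a dual space of size
`|U_n|`, while the partition of `U_n` into the `J_π` says that the lower bounds already add up to
`|U_n|`. Hence all of them are equalities (`card_twoSidedOrbit`). -/

section Arcs

variable {n : ℕ} {π π' : Finpartition (Finset.univ : Finset (Fin n))}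

theorem arcs_lt {p : Fin n × Fin n} (h : p ∈ arcs π) : p.1 < p.2 := h.1

theorem arcs_right_unique {i j l : Fin n} (h : (i, j) ∈ arcs π) (h' : (i, l) ∈ arcs π) :
    j = l := by
  obtain ⟨hij, B, hB, hi, hj, hk⟩ := h
  obtain ⟨hil, C, hC, hi', hl, hk'⟩ := h'
  obtain rfl := π.eq_of_mem_parts hB hC hi hi'
  rcases lt_trichotomy j l with h | h | h
  · exact absurd ⟨hij, h⟩ (hk' j hj)
  · exact h
  · exact absurd ⟨hil, h⟩ (hk l hl)

theorem arcs_left_unique {i k j : Fin n} (h : (i, j) ∈ arcs π) (h' : (k, j) ∈ arcs π) :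
    i = k := by
  obtain ⟨hij, B, hB, hi, hj, hk⟩ := h
  obtain ⟨hkj, C, hC, hk0, hj', hk'⟩ := h'
  obtain rfl := π.eq_of_mem_parts hB hC hj hj'
  rcases lt_trichotomy i k with h | h | h
  · exact absurd ⟨h, hkj⟩ (hk k hk0)
  · exact h
  · exact absurd ⟨h, hij⟩ (hk' i hi)

theorem arcs_subset_regularPairs : arcs π ⊆ regularPairs π := by
  rintro ⟨i, j⟩ h
  refine ⟨h.1, ?_, ?_⟩
  · rintro ⟨k, hk, hk'⟩
    exact hk.ne (arcs_left_unique hk' h)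
  · rintro ⟨l, hl, hl'⟩
    exact hl.ne (arcs_right_unique h hl')

/-- Elements of a common block are connected by arcs. -/
theorem eqvGen_arcs_of_mem {B : Finset (Fin n)} (hB : B ∈ π.parts) :
    ∀ (d : ℕ) (i j : Fin n), i ∈ B → j ∈ B → i ≤ j → (j : ℕ) - i ≤ d →
      Relation.EqvGen (fun i j => (i, j) ∈ arcs π) i j := by
  intro d
  induction d with
  | zero =>
    intro i j _ _ hij hd
    obtain rfl : i = j := by
      apply le_antisymm hij
      rw [Fin.le_def]; omega
    exact .refl _
  | succ d ih =>
    intro i j hi hj hij hd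
    rcases hij.eq_or_lt with rfl | hij
    · exact .refl _
    by_cases h : ∃ k ∈ B, i < k ∧ k < j
    · obtain ⟨k, hk, hik, hkj⟩ := h
      refine .trans _ k _ (ih i k hi hk hik.le ?_) (ih k j hk hj hkj.le ?_) <;>
        rw [Fin.lt_def] at hik hkj <;> omega
    · push Not at h
      exact .rel _ _ ⟨hij, B, hB, hi, hj, fun k hk hk' => (h k hk hk'.1).not_gt hk'.2⟩

theorem exists_part_iff_eqvGen_arcs (i j : Fin n) :
    (∃ B ∈ π.parts, i ∈ B ∧ j ∈ B) ↔ Relation.EqvGen (fun i j => (i, j) ∈ arcs π) i j := by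
  constructor
  · rintro ⟨B, hB, hi, hj⟩
    rcases le_total i j with h | h
    · exact eqvGen_arcs_of_mem hB _ i j hi hj h le_rfl
    · exact .symm _ _ (eqvGen_arcs_of_mem hB _ j i hj hi h le_rfl)
  · intro h
    induction h with
    | rel i j h =>
      obtain ⟨_, B, hB, hi, hj, _⟩ := h
      exact ⟨B, hB, hi, hj⟩
    | refl i =>
      obtain ⟨B, hB, hi⟩ := π.exists_mem (Finset.mem_univ i)
      exact ⟨B, hB, hi, hi⟩
    | symm i j _ ih =>
      obtain ⟨B, hB, hi, hj⟩ := ih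
      exact ⟨B, hB, hj, hi⟩
    | trans i j k _ _ ih ih' =>
      obtain ⟨B, hB, hi, hj⟩ := ih
      obtain ⟨C, hC, hj', hk⟩ := ih'
      obtain rfl := π.eq_of_mem_parts hB hC hj hj'
      exact ⟨B, hB, hi, hk⟩

/-- A set partition is determined by its arcs. -/
theorem arcs_injective :
    Function.Injective (arcs : Finpartition (Finset.univ : Finset (Fin n)) → _) := by
  have key : ∀ π π' : Finpartition (Finset.univ : Finset (Fin n)), arcs π = arcs π' →
      π.parts ⊆ π'.parts := by
    intro π π' h B hB
    obtain ⟨i, hi⟩ := π.nonempty_of_mem_parts hB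
    obtain ⟨C, hC, hi'⟩ := π'.exists_mem (Finset.mem_univ i)
    convert hC
    ext j
    have e : (∃ B ∈ π.parts, i ∈ B ∧ j ∈ B) ↔ ∃ B ∈ π'.parts, i ∈ B ∧ j ∈ B := by
      rw [exists_part_iff_eqvGen_arcs, exists_part_iff_eqvGen_arcs, h]
    constructor
    · intro hj
      obtain ⟨C', hC', hi'', hj'⟩ := e.1 ⟨B, hB, hi, hj⟩
      rwa [π'.eq_of_mem_parts hC hC' hi' hi'']
    · intro hj
      obtain ⟨B', hB', hi'', hj'⟩ := e.2 ⟨C, hC, hi', hj⟩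
      rwa [π.eq_of_mem_parts hB hB' hi hi'']
  intro π π' h
  exact Finpartition.ext (Finset.Subset.antisymm (key _ _ h) (key _ _ h.symm))

end Arcs

/-- In a relation that is unique on both sides, equivalent elements are joined by a directed
path. -/
theorem Relation.EqvGen.reflTransGen_or {α : Type*} {r : α → α → Prop}
    (hr : ∀ a b c, r a b → r a c → b = c) (hl : ∀ a b c, r a c → r b c → a = b) {a b : α}
    (h : Relation.EqvGen r a b) : Relation.ReflTransGen r a b ∨ Relation.ReflTransGen r b a := by
  induction h with
  | rel a b h => exact .inl (.single h)
  | refl a => exact .inl .refl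
  | symm a b _ ih => exact ih.symm
  | trans a b c _ _ ih ih' =>
    rcases ih with h | h <;> rcases ih' with h' | h'
    · exact .inl (h.trans h')
    -- Both paths end at `b`. Reversed, they start at `b`, and uniqueness of predecessors makes one
    -- extend the other.
    · have := Relation.ReflTransGen.total_of_right_unique (r := Function.swap r)
        (fun x y z h1 h2 => hl _ _ _ h1 h2) (Relation.reflTransGen_swap.2 h)
        (Relation.reflTransGen_swap.2 h')
      exact (this.imp Relation.reflTransGen_swap.1 Relation.reflTransGen_swap.1).symm
    · exact Relation.ReflTransGen.total_of_right_unique (fun x y z h1 h2 => hr _ _ _ h1 h2) h h'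
    · exact .inr (h'.trans h)

open Classical in
/-- The arcs of the partition generated by an increasing relation which is unique on both sides
are the pairs of the relation. -/
theorem arcs_ofSetoid_eqvGen {n : ℕ} {r : Fin n → Fin n → Prop}
    (hlt : ∀ i j, r i j → i < j)
    (hr : ∀ a b c, r a b → r a c → b = c) (hl : ∀ a b c, r a c → r b c → a = b) :
    arcs (Finpartition.ofSetoid (Relation.EqvGen.setoid r)) = {p | r p.1 p.2} := by
  have hle : ∀ i j, Relation.ReflTransGen r i j → i ≤ j := by
    intro i j h
    induction h with
    | refl => exact le_rfl
    | tail _ h ih => exact ih.trans (hlt _ _ h).le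
  have hpart : ∀ B ∈ (Finpartition.ofSetoid (Relation.EqvGen.setoid r)).parts, ∀ i ∈ B,
      ∀ j, j ∈ B ↔ Relation.EqvGen r i j := by
    intro B hB i hi j
    have h1 := Finpartition.part_eq_of_mem _ hB hi
    rw [← h1]
    exact Finpartition.mem_part_ofSetoid_iff_rel
  ext ⟨i, j⟩
  constructor
  · rintro ⟨hij, B, hB, hi, hj, hk⟩
    have h := (hpart B hB i hi j).1 hj
    rcases h.reflTransGen_or hr hl with h | h
    -- The first vertex `k` of the path lies in the block after `i`; consecutiveness of `i` and `j`
    -- forces `k = j`.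
    · rcases Relation.ReflTransGen.cases_head h with h | ⟨k, hik, hkj⟩
      · exact absurd h hij.ne
      · rcases (hle _ _ hkj).eq_or_lt with rfl | hlt'
        · exact hik
        · exact absurd ⟨hlt _ _ hik, hlt'⟩ (hk k ((hpart B hB i hi k).2 (.rel _ _ hik)))
    · exact absurd (hle _ _ h) hij.not_ge
  · intro h
    have h : r i j := h
    obtain ⟨B, hB, hi⟩ := (Finpartition.ofSetoid (Relation.EqvGen.setoid r)).exists_mem
      (Finset.mem_univ i)
    refine ⟨hlt _ _ h, B, hB, hi, (hpart B hB i hi j).2 (.rel _ _ h), ?_⟩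
    rintro k hk ⟨hik, hkj⟩
    rcases ((hpart B hB i hi k).1 hk).reflTransGen_or hr hl with h' | h'
    · rcases Relation.ReflTransGen.cases_head h' with h' | ⟨l, hil, hlk⟩
      · exact hik.ne h'
      · obtain rfl := hr _ _ _ h hil
        exact absurd (hle _ _ hlk) hkj.not_ge
    · exact absurd (hle _ _ h') hik.not_ge

/-- The decidability instances of the two setoids need not match, so rewriting alone does not
suffice. -/
theorem ofSetoid_congr {n : ℕ} {s t : Setoid (Fin n)} [DecidableRel s.r] [DecidableRel t.r]
    (h : s = t) : Finpartition.ofSetoid s = Finpartition.ofSetoid t := by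
  subst h
  congr!

theorem Relation.eqvGen_setoid_congr {α : Type*} {r s : α → α → Prop}
    (hrs : ∀ a b, r a b → Relation.EqvGen s a b) (hsr : ∀ a b, s a b → Relation.EqvGen r a b) :
    Relation.EqvGen.setoid r = Relation.EqvGen.setoid s := by
  have key : ∀ {r s : α → α → Prop}, (∀ a b, r a b → Relation.EqvGen s a b) →
      ∀ a b, Relation.EqvGen r a b → Relation.EqvGen s a b := by
    intro r s h a b hab
    induction hab with
    | rel a b hab => exact h a b hab
    | refl a => exact .refl a
    | symm a b _ ih => exact .symm _ _ ih
    | trans a b c _ _ ih ih' => exact .trans _ _ _ ih ih'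
  exact Setoid.ext fun a b => ⟨key hrs a b, key hsr a b⟩

/-! ### Unitriangular matrices -/

section Unitriangular

variable {n : ℕ} {K : Type*} [Field K]

theorem uniMatrix_diag (A : unitriangular n K) (i : Fin n) : uniMatrix A i i = 1 := A.2.1 i

theorem uniMatrix_lower (A : unitriangular n K) {i j : Fin n} (h : j < i) :
    uniMatrix A i j = 0 := A.2.2 i j h

/-- The unitriangular matrix with prescribed entries above the diagonal. -/
noncomputable def uniOfEntries (f : Fin n → Fin n → K) : unitriangular n K :=
  ⟨Matrix.GeneralLinearGroup.mkOfDetNeZero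
    (Matrix.of fun i j => if i < j then f i j else if i = j then 1 else 0) (by
      rw [Matrix.det_of_isUpperTriangular]
      · simp
      · intro i j h
        have h : j < i := h
        simp [h.not_gt, h.ne']), by
    refine ⟨fun i => ?_, fun i j h => ?_⟩
    · simp [Matrix.GeneralLinearGroup.mkOfDetNeZero]
    · simp [Matrix.GeneralLinearGroup.mkOfDetNeZero, h.not_gt, h.ne']⟩

theorem uniMatrix_uniOfEntries (f : Fin n → Fin n → K) (i j : Fin n) :
    uniMatrix (uniOfEntries f) i j = if i < j then f i j else if i = j then 1 else 0 := by
  simp [uniMatrix, uniOfEntries, Matrix.GeneralLinearGroup.mkOfDetNeZero]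

theorem uniMatrix_uniOfEntries_of_lt (f : Fin n → Fin n → K) {i j : Fin n} (h : i < j) :
    uniMatrix (uniOfEntries f) i j = f i j := by
  rw [uniMatrix_uniOfEntries, if_pos h]

theorem unitriangular_ext {A B : unitriangular n K}
    (h : ∀ i j, i < j → uniMatrix A i j = uniMatrix B i j) : A = B := by
  apply Subtype.ext
  apply Units.ext
  ext i j
  change uniMatrix A i j = uniMatrix B i j
  rcases lt_trichotomy i j with h' | rfl | h'
  · exact h i j h'
  · rw [uniMatrix_diag, uniMatrix_diag]
  · rw [uniMatrix_lower A h', uniMatrix_lower B h']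

theorem uniSubOne_bijective : Function.Bijective (uniSubOne : unitriangular n K → _) := by
  constructor
  · intro A B h
    have h : uniMatrix A - 1 = uniMatrix B - 1 := congrArg Subtype.val h
    have h := sub_left_injective h
    exact unitriangular_ext fun i j _ => by rw [h]
  · rintro ⟨x, hx⟩
    refine ⟨uniOfEntries fun i j => x i j, Subtype.ext ?_⟩
    ext i j
    change uniMatrix (uniOfEntries fun i j => x i j) i j - (1 : Matrix (Fin n) (Fin n) K) i j = x i j
    rw [uniMatrix_uniOfEntries, Matrix.one_apply]
    split_ifs with h1 h2
    · exact absurd h2 h1.ne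
    · simp
    · simp [hx i j (not_lt.1 h1)]
    · simp [hx i j (not_lt.1 h1)]

theorem uniSubOne_one : uniSubOne (1 : unitriangular n K) = 0 := by
  apply Subtype.ext
  simp [uniSubOne, uniMatrix]

/-! ### The reduction algorithm -/

/-- The last step has offset `0` and treats the main diagonal itself, whose entries `1` stay `1`;
all other steps leave the diagonal alone. -/
theorem reduceSteps_diag (A : unitriangular n K) (k : ℕ) (i : Fin n) :
    reduceSteps (uniMatrix A) k i i = 1 := by
  induction k with
  | zero => exact uniMatrix_diag A i
  | succ k ih => simp [reduceSteps, clearDiagonal, ih]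

theorem reduceSteps_lower (A : unitriangular n K) (k : ℕ) {i j : Fin n} (h : j < i) :
    reduceSteps (uniMatrix A) k i j = 0 := by
  induction k with
  | zero => exact uniMatrix_lower A h
  | succ k ih => simp [reduceSteps, clearDiagonal, ih, h.not_gt]

open Classical in
/-- The state of the algorithm when the diagonals `j - i ≥ n - k` have been processed, in terms
of the input and of the nonzero entries left on these diagonals. -/
theorem reduceSteps_apply (A : Matrix (Fin n) (Fin n) K) (k : ℕ) (hk : k ≤ n) :
    ∀ i j : Fin n, i < j → reduceSteps A k i j =
      if (∃ l, j < l ∧ (i : ℕ) + (n - k) ≤ l ∧ reduceSteps A k i l ≠ 0) ∨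
          ∃ m, m < i ∧ (m : ℕ) + (n - k) ≤ j ∧ reduceSteps A k m j ≠ 0 then 0
      else if (i : ℕ) + (n - k) ≤ j then (if A i j ≠ 0 then 1 else 0) else A i j := by
  induction k with
  | zero =>
    intro i j hij
    rw [if_neg, if_neg]
    · rfl
    · omega
    · rintro (⟨l, _, h, _⟩ | ⟨m, _, h, _⟩) <;> omega
  | succ k ih =>
    specialize ih (by omega)
    obtain ⟨d, hd⟩ : ∃ d, d = n - (k + 1) := ⟨_, rfl⟩
    have hd' : n - k = d + 1 := by omega
    set M := reduceSteps A k with hM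
    have hM' : reduceSteps A (k + 1) = clearDiagonal d M := by rw [hd]; rfl
    rw [← hd, hM']
    rw [hd'] at ih
    have hbig : ∀ i j : Fin n, (i : ℕ) + d < j → clearDiagonal d M i j = M i j := by
      intro i j h
      simp only [clearDiagonal, Matrix.of_apply]
      rw [if_neg (by omega), if_neg]
      rintro ⟨_, ⟨l, h1, h2, _⟩ | ⟨m, h1, h2, _⟩⟩ <;> rw [Fin.lt_def] at h2 <;> omega
    have heq : ∀ i j : Fin n, (j : ℕ) = i + d →
        clearDiagonal d M i j = if M i j ≠ 0 then 1 else 0 := by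
      intro i j h
      simp only [clearDiagonal, Matrix.of_apply]
      by_cases h0 : M i j = 0
      · simp [h0]
      · simp [h0, h]
    -- The step moves no zero on the diagonals processed so far, so the clearing conditions may be
    -- read in `M` instead of the new state.
    have hpiv : ∀ i j : Fin n, (i : ℕ) + d ≤ j → (clearDiagonal d M i j ≠ 0 ↔ M i j ≠ 0) := by
      intro i j h
      rcases h.eq_or_lt with h | h
      · rw [heq i j h.symm]; simp
      · rw [hbig i j h]
    intro i j hij
    have hrow : (∃ l, j < l ∧ (i : ℕ) + d ≤ l ∧ clearDiagonal d M i l ≠ 0) ↔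
        ∃ l, j < l ∧ (i : ℕ) + d ≤ l ∧ M i l ≠ 0 :=
      exists_congr fun l => and_congr_right fun _ => and_congr_right fun h => hpiv i l h
    have hcol : (∃ m, m < i ∧ (m : ℕ) + d ≤ j ∧ clearDiagonal d M m j ≠ 0) ↔
        ∃ m, m < i ∧ (m : ℕ) + d ≤ j ∧ M m j ≠ 0 :=
      exists_congr fun m => and_congr_right fun _ => and_congr_right fun h => hpiv m j h
    refine Eq.trans ?_ (if_congr (or_congr hrow hcol) rfl rfl).symm
    have hij' : (i : ℕ) < j := hij
    by_cases h1 : (i : ℕ) + d ≤ j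
    -- Here any position to the right of or above `(i, j)` has offset greater than `d`, so the
    -- thresholds `d` and `d + 1` agree.
    · have hrow' : (∃ l, j < l ∧ (i : ℕ) + d ≤ l ∧ M i l ≠ 0) ↔
          ∃ l, j < l ∧ (i : ℕ) + (d + 1) ≤ l ∧ M i l ≠ 0 :=
        exists_congr fun l => and_congr_right fun h => and_congr_left fun _ => by
          rw [Fin.lt_def] at h; omega
      have hcol' : (∃ m, m < i ∧ (m : ℕ) + d ≤ j ∧ M m j ≠ 0) ↔
          ∃ m, m < i ∧ (m : ℕ) + (d + 1) ≤ j ∧ M m j ≠ 0 :=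
        exists_congr fun m => and_congr_right fun h => and_congr_left fun _ => by
          rw [Fin.lt_def] at h; omega
      refine Eq.trans ?_ (if_congr (or_congr hrow' hcol') rfl rfl).symm
      rw [if_pos h1]
      have := ih i j hij
      rcases h1.eq_or_lt with h1 | h1
      · rw [heq i j h1.symm, this]
        rw [if_neg (c := (i : ℕ) + (d + 1) ≤ j) (by omega)]
        split_ifs <;> simp_all
      · rw [hbig i j h1, this, if_pos (c := (i : ℕ) + (d + 1) ≤ j) (by omega)]
    · rw [if_neg h1]
      have := ih i j hij
      rw [if_neg (c := (i : ℕ) + (d + 1) ≤ j) (by omega)] at this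
      simp only [clearDiagonal, Matrix.of_apply]
      rw [if_neg (by omega)]
      -- For an entry not yet reached, the only new cause of clearing is a nonzero entry on the
      -- diagonal of offset `d`.
      by_cases h2 : (∃ l : Fin n, (l : ℕ) = i + d ∧ j < l ∧ M i l ≠ 0) ∨
        ∃ k : Fin n, (j : ℕ) = k + d ∧ k < i ∧ M k j ≠ 0
      · rw [if_pos ⟨hij, h2⟩, if_pos]
        rcases h2 with ⟨l, ha, hb, hc⟩ | ⟨m, ha, hb, hc⟩
        · exact .inl ⟨l, hb, by omega, hc⟩
        · exact .inr ⟨m, hb, by omega, hc⟩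
      · rw [if_neg (fun h => h2 h.2), this]
        refine if_congr ?_ rfl rfl
        push Not at h2
        constructor
        · rintro (⟨l, ha, hb, hc⟩ | ⟨m, ha, hb, hc⟩)
          · exact .inl ⟨l, ha, by omega, hc⟩
          · exact .inr ⟨m, ha, by omega, hc⟩
        · rintro (⟨l, ha, hb, hc⟩ | ⟨m, ha, hb, hc⟩)
          · refine .inl ⟨l, ha, ?_, hc⟩
            by_contra hne
            exact hc (h2.1 l (by omega) ha)
          · refine .inr ⟨m, ha, ?_, hc⟩
            by_contra hne
            exact hc (h2.2 m (by omega) ha)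

open Classical in
-- At `k = n` the threshold `n - k` is `0` and disappears. With the values on and below the
-- diagonal, this recursion is all that is used of the algorithm afterwards.
theorem reduceMatrix_apply (A : unitriangular n K) {i j : Fin n} (hij : i < j) :
    reduceMatrix A i j =
      if (∃ l, j < l ∧ reduceMatrix A i l ≠ 0) ∨ ∃ m, m < i ∧ reduceMatrix A m j ≠ 0 then 0
      else if uniMatrix A i j ≠ 0 then 1 else 0 := by
  have h := reduceSteps_apply (uniMatrix A) n le_rfl i j hij
  rw [Nat.sub_self, if_pos (c := (i : ℕ) + 0 ≤ j) hij.le] at h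
  have hij' : (i : ℕ) < j := hij
  have e : ∀ P : Fin n → Prop, (∃ l, j < l ∧ (i : ℕ) + 0 ≤ l ∧ P l) ↔ ∃ l, j < l ∧ P l :=
    fun P => exists_congr fun l => and_congr_right fun h => by
      rw [Fin.lt_def] at h
      exact and_iff_right (by omega)
  have e' : ∀ P : Fin n → Prop, (∃ m, m < i ∧ (m : ℕ) + 0 ≤ j ∧ P m) ↔ ∃ m, m < i ∧ P m :=
    fun P => exists_congr fun l => and_congr_right fun h => by
      rw [Fin.lt_def] at h
      exact and_iff_right (by omega)
  exact h.trans (if_congr (or_congr (e _) (e' _)) rfl rfl)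

open Classical in
-- By the recursion, two nonzero output entries above the diagonal never share a row or a column, so
-- `arcs_ofSetoid_eqvGen` applies.
theorem arcs_readPartition (A : unitriangular n K) :
    arcs (readPartition A) = {p | p.1 < p.2 ∧ reduceMatrix A p.1 p.2 ≠ 0} := by
  -- The diagonal entries `1` only contribute loops.
  have hset : (Relation.EqvGen.setoid fun i j => reduceMatrix A i j ≠ 0) =
      Relation.EqvGen.setoid fun i j => i < j ∧ reduceMatrix A i j ≠ 0 := by
    apply Relation.eqvGen_setoid_congr
    · intro i j h
      rcases lt_trichotomy i j with h' | rfl | h'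
      · exact .rel _ _ ⟨h', h⟩
      · exact .refl _
      · exact absurd (reduceSteps_lower A n h') h
    · exact fun i j h => .rel _ _ h.2
  rw [readPartition, ofSetoid_congr hset]
  apply arcs_ofSetoid_eqvGen
  · exact fun i j h => h.1
  · have key : ∀ i j l, i < j → j < l → reduceMatrix A i j ≠ 0 → reduceMatrix A i l ≠ 0 →
        False := by
      intro i j l hij hjl h h'
      rw [reduceMatrix_apply A hij, if_pos (.inl ⟨l, hjl, h'⟩)] at h
      exact h rfl
    intro i j l h h'
    rcases lt_trichotomy j l with h1 | h1 | h1
    · exact (key i j l h.1 h1 h.2 h'.2).elim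
    · exact h1
    · exact (key i l j h'.1 h1 h'.2 h.2).elim
  · have key : ∀ m i j, m < i → i < j → reduceMatrix A m j ≠ 0 → reduceMatrix A i j ≠ 0 →
        False := by
      intro m i j hmi hij h' h
      rw [reduceMatrix_apply A hij, if_pos (.inr ⟨m, hmi, h'⟩)] at h
      exact h rfl
    intro i m j h h'
    rcases lt_trichotomy i m with h1 | h1 | h1
    · exact (key i m j h1 h'.1 h.2 h'.2).elim
    · exact h1
    · exact (key m i j h1 h.1 h'.2 h.2).elim

/-- At a regular pair nothing triggers clearing, so input and output vanish together there. -/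
theorem mem_Jset_readPartition (A : unitriangular n K) : A ∈ Jset K (readPartition A) := by
  have harcs := arcs_readPartition A
  refine ⟨?_, ?_⟩
  · rintro ⟨i, j⟩ h
    rw [harcs] at h
    obtain ⟨hij, h⟩ := h
    intro h0
    apply h
    dsimp only at hij h0 ⊢
    rw [reduceMatrix_apply A hij]
    simp [h0]
  · rintro ⟨i, j⟩ ⟨⟨hij, h1, h2⟩, h3⟩
    rw [harcs] at h1 h2 h3
    dsimp only at hij h1 h2 ⊢
    by_contra h0
    apply h3
    refine ⟨hij, ?_⟩
    dsimp only
    rw [reduceMatrix_apply A hij, if_neg]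
    · simp [h0]
    · rintro (⟨l, hl, hl'⟩ | ⟨m, hm, hm'⟩)
      · exact h2 ⟨l, hl, hij.trans hl, hl'⟩
      · exact h1 ⟨m, hm, hm.trans hij, hm'⟩

theorem reduceMatrix_eq_canonicalMatrix (A : unitriangular n K) :
    reduceMatrix A = canonicalMatrix K (readPartition A) := by
  ext i j
  have harcs : (i, j) ∈ arcs (readPartition A) ↔ i < j ∧ reduceMatrix A i j ≠ 0 := by
    rw [arcs_readPartition]
    exact Iff.rfl
  simp only [canonicalMatrix, Matrix.of_apply]
  rcases lt_trichotomy i j with h | rfl | h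
  · by_cases h0 : reduceMatrix A i j = 0
    · rw [h0, if_neg]
      rintro (h' | h')
      · exact (harcs.1 h').2 h0
      · exact h.ne h'
    · rw [if_pos (.inl (harcs.2 ⟨h, h0⟩))]
      rw [reduceMatrix_apply A h] at h0 ⊢
      split_ifs at h0 ⊢ <;> simp_all
  · rw [if_pos (.inr rfl)]
    exact reduceSteps_diag A n i
  · rw [if_neg]
    · exact reduceSteps_lower A n h
    · rintro (h' | h')
      · exact h.not_gt h'.1
      · exact h.ne' h'

/-! ### The sets `J_π` -/

variable {π π' : Finpartition (Finset.univ : Finset (Fin n))}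

/-- The nonzero entries of a matrix of `J_π` determine the arcs of `π`, starting from the upper
right corner. -/
theorem eq_of_mem_Jset {A : unitriangular n K} (h : A ∈ Jset K π) (h' : A ∈ Jset K π') :
    π = π' := by
  apply arcs_injective
  -- Whether `(i, j)` is an arc depends only on `A` and on arcs of greater length, which permits
  -- induction on `n - (j - i)`.
  have hiff : ∀ {π : Finpartition (Finset.univ : Finset (Fin n))}, A ∈ Jset K π →
      ∀ i j, i < j → ((i, j) ∈ arcs π ↔ uniMatrix A i j ≠ 0 ∧
        (¬∃ k, k < i ∧ (k, j) ∈ arcs π) ∧ ¬∃ l, j < l ∧ (i, l) ∈ arcs π) := by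
    intro π h i j hij
    constructor
    · intro hp
      exact ⟨h.1 _ hp, (arcs_subset_regularPairs hp).2⟩
    · rintro ⟨h0, hr⟩
      by_contra hp
      exact h0 (h.2 (i, j) ⟨⟨hij, hr⟩, hp⟩)
  have key : ∀ (d : ℕ) (i j : Fin n), i < j → n - ((j : ℕ) - i) ≤ d →
      ((i, j) ∈ arcs π ↔ (i, j) ∈ arcs π') := by
    intro d
    induction d with
    | zero => intro i j hij hd; omega
    | succ d ih =>
      intro i j hij hd
      have hij' : (i : ℕ) < j := hij
      rw [hiff h i j hij, hiff h' i j hij]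
      refine and_congr_right fun _ => and_congr (not_congr ?_) (not_congr ?_)
      · refine exists_congr fun k => and_congr_right fun hk => ?_
        rw [Fin.lt_def] at hk
        exact ih k j (Fin.lt_def.2 (by omega)) (by omega)
      · refine exists_congr fun l => and_congr_right fun hl => ?_
        rw [Fin.lt_def] at hl
        exact ih i l (Fin.lt_def.2 (by omega)) (by omega)
  ext ⟨i, j⟩
  by_cases hij : i < j
  · exact key _ i j hij le_rfl
  · exact iff_of_false (fun h => hij h.1) (fun h => hij h.1)

theorem mem_Jset_iff_readPartition {A : unitriangular n K} :
    A ∈ Jset K π ↔ readPartition A = π := by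
  constructor
  · exact fun h => eq_of_mem_Jset (mem_Jset_readPartition A) h
  · rintro rfl
    exact mem_Jset_readPartition A

/-- The pairs `i < j` which are not `π`-regular. -/
def singularPairs (π : Finpartition (Finset.univ : Finset (Fin n))) : Set (Fin n × Fin n) :=
  {p | p.1 < p.2 ∧ p ∉ regularPairs π}

open Classical in
/-- A matrix of `J_π` amounts to nonzero entries at the arcs and arbitrary entries at the
singular pairs. -/
noncomputable def JsetEquiv (K : Type*) [Field K]
    (π : Finpartition (Finset.univ : Finset (Fin n))) :
    Jset K π ≃ (arcs π → Kˣ) × (singularPairs π → K) where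
  toFun A := (fun p => Units.mk0 (uniMatrix A.1 p.1.1 p.1.2) (A.2.1 p.1 p.2),
    fun p => uniMatrix A.1 p.1.1 p.1.2)
  invFun f := ⟨uniOfEntries fun i j => if h : (i, j) ∈ arcs π then f.1 ⟨_, h⟩ else
      if h : (i, j) ∈ singularPairs π then f.2 ⟨_, h⟩ else 0, by
    refine ⟨fun p hp => ?_, fun p hp => ?_⟩
    · rw [uniMatrix_uniOfEntries_of_lt _ (arcs_lt hp), dif_pos hp]
      exact Units.ne_zero _
    · rw [uniMatrix_uniOfEntries_of_lt _ hp.1.1, dif_neg hp.2, dif_neg]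
      exact fun h => h.2 hp.1⟩
  left_inv := by
    rintro ⟨A, hA⟩
    apply Subtype.ext
    refine unitriangular_ext fun i j hij => ?_
    rw [uniMatrix_uniOfEntries_of_lt _ hij]
    split_ifs with h1 h2
    · rfl
    · rfl
    · refine (hA.2 (i, j) ⟨?_, h1⟩).symm
      by_contra h
      exact h2 ⟨hij, h⟩
  right_inv := by
    rintro ⟨φ, s⟩
    refine Prod.ext (funext fun p => Units.ext ?_) (funext fun p => ?_)
    · simp only [Units.val_mk0]
      rw [uniMatrix_uniOfEntries_of_lt _ (arcs_lt p.2), dif_pos p.2]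
    · dsimp only
      rw [uniMatrix_uniOfEntries_of_lt _ p.2.1,
        dif_neg fun h => p.2.2 (arcs_subset_regularPairs h), dif_pos p.2]

theorem Jset_nonempty : (Jset K π).Nonempty :=
  ⟨_, ((JsetEquiv K π).symm (fun _ => 1, fun _ => 0)).2⟩

theorem Jset_injective :
    Function.Injective
      (Jset K : Finpartition (Finset.univ : Finset (Fin n)) → Set (unitriangular n K)) := by
  intro π π' h
  obtain ⟨A, hA⟩ := Jset_nonempty (K := K) (π := π)
  have h : Jset K π = Jset K π' := h
  exact eq_of_mem_Jset hA (h ▸ hA)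

theorem isPartition_range_Jset :
    Setoid.IsPartition (Set.range
      (Jset K : Finpartition (Finset.univ : Finset (Fin n)) → Set (unitriangular n K))) := by
  constructor
  · rintro ⟨π, h⟩
    exact Jset_nonempty.ne_empty h
  · intro A
    refine ⟨_, ⟨⟨readPartition A, rfl⟩, mem_Jset_readPartition A⟩, ?_⟩
    rintro _ ⟨⟨π, rfl⟩, hA⟩
    rw [mem_Jset_iff_readPartition.1 hA]

end Unitriangular

/-! ### Orbits of functionals -/

section Orbits

variable {n : ℕ} {K : Type*} [Field K] {π π' : Finpartition (Finset.univ : Finset (Fin n))}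

/-- The strictly upper triangular matrix units. -/
def upperUnit (K : Type*) [Field K] {a b : Fin n} (h : a < b) : strictlyUpper n K :=
  ⟨Matrix.single a b 1, fun i j hij => by
    rw [Matrix.single_apply, if_neg]
    rintro ⟨rfl, rfl⟩
    exact hij.not_gt h⟩

theorem mul_single_mul_apply (A B : Matrix (Fin n) (Fin n) K) (a b i j : Fin n) :
    (A * Matrix.single a b 1 * B : Matrix (Fin n) (Fin n) K) i j = A i a * B b j := by
  rw [Matrix.mul_apply, Finset.sum_eq_single b]
  · simp
  · intro c _ hc
    simp [hc]
  · simp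

open Classical in
theorem arcFunctional_upperUnit (φ : arcs π → Kˣ) (g h : unitriangular n K) {a b : Fin n}
    (hab : a < b) :
    arcFunctional π φ g h (upperUnit K hab) =
      ∑ p : arcs π, (φ p : K) * (uniMatrix g p.1.1 a * uniMatrix h b p.1.2) := by
  refine Finset.sum_congr rfl fun p _ => ?_
  rw [upperUnit, mul_single_mul_apply]

/-- Two-sided translation by unitriangular matrices preserves the strictly upper triangular
matrices. -/
theorem uniMatrix_mul_mem_strictlyUpper (g h : unitriangular n K)
    {x : Matrix (Fin n) (Fin n) K} (hx : x ∈ strictlyUpper n K) :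
    uniMatrix g * x * uniMatrix h ∈ strictlyUpper n K := by
  intro i j hij
  rw [Matrix.mul_apply]
  refine Finset.sum_eq_zero fun b _ => ?_
  rcases lt_or_ge j b with hb | hb
  · rw [uniMatrix_lower h hb, mul_zero]
  rw [Matrix.mul_apply, Finset.sum_eq_zero, zero_mul]
  intro a _
  rcases lt_or_ge a i with ha | ha
  · rw [uniMatrix_lower g ha, zero_mul]
  · rw [hx a b ((hb.trans hij).trans ha), mul_zero]

theorem uniMatrix_mul (g h : unitriangular n K) :
    uniMatrix (g * h) = uniMatrix g * uniMatrix h := rfl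

theorem uniMatrix_one : uniMatrix (1 : unitriangular n K) = 1 := rfl

theorem arcFunctional_translate (φ : arcs π → Kˣ) (g h g' h' : unitriangular n K)
    {x : Matrix (Fin n) (Fin n) K} (hx : x ∈ strictlyUpper n K) :
    arcFunctional π φ g h ⟨_, uniMatrix_mul_mem_strictlyUpper g' h' hx⟩ =
      arcFunctional π φ (g * g') (h' * h) ⟨x, hx⟩ := by
  refine Finset.sum_congr rfl fun p _ => ?_
  simp only [uniMatrix_mul, Matrix.mul_assoc]

open Classical in
/-- The functional `x ↦ λ(gx)` has the value of the colouring at an arc, and vanishes off the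
arcs and the positions below them. -/
theorem arcFunctional_left_arc (φ : arcs π → Kˣ) (g : unitriangular n K) (p : arcs π) :
    arcFunctional π φ g 1 (upperUnit K (arcs_lt p.2)) = φ p := by
  rw [arcFunctional_upperUnit, Finset.sum_eq_single p]
  · rw [uniMatrix_diag, uniMatrix_diag, mul_one, mul_one]
  · rintro ⟨⟨i, j⟩, hp'⟩ _ hne
    obtain ⟨⟨k, l⟩, hp⟩ := p
    rw [uniMatrix_one, Matrix.one_apply_ne, mul_zero, mul_zero]
    rintro h
    dsimp only at h
    subst h
    obtain rfl := arcs_left_unique hp hp'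
    exact hne rfl
  · simp

open Classical in
theorem exists_arc_of_arcFunctional_left_ne_zero {φ : arcs π → Kˣ} {g : unitriangular n K}
    {a b : Fin n} {hab : a < b} (h : arcFunctional π φ g 1 (upperUnit K hab) ≠ 0) :
    ∃ i, i ≤ a ∧ (i, b) ∈ arcs π := by
  rw [arcFunctional_upperUnit] at h
  obtain ⟨⟨⟨i, j⟩, hp⟩, -, h⟩ := Finset.exists_ne_zero_of_sum_ne_zero h
  dsimp only at h
  have hbj : b = j := by
    by_contra hne
    rw [uniMatrix_one, Matrix.one_apply_ne hne, mul_zero, mul_zero] at h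
    exact h rfl
  subst hbj
  refine ⟨i, ?_, hp⟩
  by_contra hi
  rw [uniMatrix_lower g (not_le.1 hi), zero_mul, mul_zero] at h
  exact h rfl

open Classical in
/-- The functional `x ↦ λ(xh)` has the value of the colouring at an arc, and vanishes off the
arcs and the positions to their left. -/
theorem arcFunctional_right_arc (φ : arcs π → Kˣ) (h : unitriangular n K) (p : arcs π) :
    arcFunctional π φ 1 h (upperUnit K (arcs_lt p.2)) = φ p := by
  rw [arcFunctional_upperUnit, Finset.sum_eq_single p]
  · rw [uniMatrix_diag, uniMatrix_diag, mul_one, mul_one]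
  · rintro ⟨⟨i, j⟩, hp'⟩ _ hne
    obtain ⟨⟨k, l⟩, hp⟩ := p
    rw [uniMatrix_one, Matrix.one_apply_ne, zero_mul, mul_zero]
    rintro h
    dsimp only at h
    subst h
    obtain rfl := arcs_right_unique hp hp'
    exact hne rfl
  · simp

open Classical in
theorem exists_arc_of_arcFunctional_right_ne_zero {φ : arcs π → Kˣ} {h : unitriangular n K}
    {a b : Fin n} {hab : a < b} (h0 : arcFunctional π φ 1 h (upperUnit K hab) ≠ 0) :
    ∃ l, b ≤ l ∧ (a, l) ∈ arcs π := by
  rw [arcFunctional_upperUnit] at h0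
  obtain ⟨⟨⟨i, j⟩, hp⟩, -, h0⟩ := Finset.exists_ne_zero_of_sum_ne_zero h0
  dsimp only at h0
  have hia : i = a := by
    by_contra hne
    rw [uniMatrix_one, Matrix.one_apply_ne hne, zero_mul, mul_zero] at h0
    exact h0 rfl
  subst hia
  refine ⟨j, ?_, hp⟩
  by_contra hj
  rw [uniMatrix_lower h (not_le.1 hj), mul_zero, mul_zero] at h0
  exact h0 rfl

/-- Functionals of coloured set partitions with meeting orbits have the same arcs and colours. -/
theorem arcs_eq_of_arcFunctional_eq {φ : arcs π → Kˣ} {φ' : arcs π' → Kˣ}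
    {g h g' h' : unitriangular n K} (e : arcFunctional π φ g h = arcFunctional π' φ' g' h') :
    arcs π = arcs π' ∧ ∀ p (hp : p ∈ arcs π) (hp' : p ∈ arcs π'), φ ⟨p, hp⟩ = φ' ⟨p, hp'⟩ := by
  -- Substituting `g'⁻¹ x h⁻¹` for `x` leaves one functional translated only on the left and the
  -- other only on the right.
  obtain ⟨u, v, e⟩ : ∃ u v : unitriangular n K,
      arcFunctional π φ u 1 = arcFunctional π' φ' 1 v := by
    refine ⟨g * g'⁻¹, h⁻¹ * h', LinearMap.ext fun x => ?_⟩
    have := LinearMap.congr_fun e ⟨_, uniMatrix_mul_mem_strictlyUpper g'⁻¹ h⁻¹ x.2⟩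
    rwa [arcFunctional_translate, arcFunctional_translate, inv_mul_cancel, mul_inv_cancel] at this
  have key : ∀ (d : ℕ) (i j : Fin n), i < j → n - ((j : ℕ) - i) ≤ d →
      ((i, j) ∈ arcs π ↔ (i, j) ∈ arcs π') := by
    intro d
    induction d with
    | zero => intro i j hij hd; omega
    | succ d ih =>
      intro i j hij hd
      have hij' : (i : ℕ) < j := hij
      constructor
      -- The common functional is nonzero at an arc `(i, j)` of `π`, so `π'` has an arc `(i, l)`
      -- with `j ≤ l`. If `j < l`, induction makes it a second arc of `π` from `i`. The converse is
      -- the same argument in columns.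
      · intro hp
        have h0 := arcFunctional_left_arc φ u ⟨(i, j), hp⟩
        rw [e] at h0
        obtain ⟨l, hjl, hl⟩ := exists_arc_of_arcFunctional_right_ne_zero
          (h0.trans_ne (Units.ne_zero _))
        rcases hjl.eq_or_lt with h | h
        · rwa [show j = l from h]
        · have h : (j : ℕ) < l := h
          have hl' := (ih i l (Fin.lt_def.2 (by omega)) (by omega)).2 hl
          obtain rfl := arcs_right_unique hp hl'
          exact absurd h (lt_irrefl _)
      · intro hp
        have h0 := arcFunctional_right_arc φ' v ⟨(i, j), hp⟩
        rw [← e] at h0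
        obtain ⟨k, hki, hk⟩ := exists_arc_of_arcFunctional_left_ne_zero
          (h0.trans_ne (Units.ne_zero _))
        rcases hki.eq_or_lt with h | h
        · rwa [← show k = i from h]
        · have h : (k : ℕ) < i := h
          have hk' := (ih k j (Fin.lt_def.2 (by omega)) (by omega)).1 hk
          obtain rfl := arcs_left_unique hp hk'
          exact absurd h (lt_irrefl _)
  constructor
  · ext ⟨i, j⟩
    by_cases hij : i < j
    · exact key _ i j hij le_rfl
    · exact iff_of_false (fun h => hij h.1) (fun h => hij h.1)
  · intro p hp hp'
    have h1 := arcFunctional_left_arc φ u ⟨p, hp⟩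
    have h2 := arcFunctional_right_arc φ' v ⟨p, hp'⟩
    rw [e] at h1
    exact Units.ext (h1.symm.trans h2)

/-! ### The size of the orbits -/

open Classical in
/-- The unitriangular matrix whose entry at `(k, a)` is `x a b` if there is an arc `(k, b)` with
`k < a < b`. -/
noncomputable def rowParam (π : Finpartition (Finset.univ : Finset (Fin n)))
    (x : Fin n → Fin n → K) : unitriangular n K :=
  uniOfEntries fun k a => ∑ b, if (k, b) ∈ arcs π ∧ a < b then x a b else 0

open Classical in
/-- The unitriangular matrix whose entry at `(b, l)` is `x a b` if there is an arc `(a, l)` with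
`a < b < l`, unless `(a, b)` is also below an arc. -/
noncomputable def colParam (π : Finpartition (Finset.univ : Finset (Fin n)))
    (x : Fin n → Fin n → K) : unitriangular n K :=
  uniOfEntries fun b l => ∑ a,
    if (a, l) ∈ arcs π ∧ a < b ∧ ¬∃ k, k < a ∧ (k, b) ∈ arcs π then x a b else 0

theorem rowParam_apply {k a b : Fin n} (x : Fin n → Fin n → K) (hk : (k, b) ∈ arcs π)
    (hka : k < a) (hab : a < b) : uniMatrix (rowParam π x) k a = x a b := by
  rw [rowParam, uniMatrix_uniOfEntries_of_lt _ hka, Finset.sum_eq_single b]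
  · rw [if_pos ⟨hk, hab⟩]
  · intro c _ hc
    rw [if_neg]
    rintro ⟨hc', -⟩
    exact hc (arcs_right_unique hc' hk)
  · simp

open Classical in
theorem colParam_apply {a b l : Fin n} (x : Fin n → Fin n → K) (hl : (a, l) ∈ arcs π)
    (hab : a < b) (hbl : b < l) : uniMatrix (colParam π x) b l =
      if ∃ k, k < a ∧ (k, b) ∈ arcs π then 0 else x a b := by
  rw [colParam, uniMatrix_uniOfEntries_of_lt _ hbl, Finset.sum_eq_single a]
  · by_cases h : ∃ k, k < a ∧ (k, b) ∈ arcs π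
    · rw [if_pos h, if_neg fun h' => h'.2.2 h]
    · rw [if_neg h, if_pos ⟨hl, hab, h⟩]
  · intro c _ hc
    rw [if_neg]
    rintro ⟨hc', -⟩
    exact hc (arcs_left_unique hc' hl)
  · simp

theorem mem_singularPairs_iff {a b : Fin n} : (a, b) ∈ singularPairs π ↔
    a < b ∧ ((∃ k, k < a ∧ (k, b) ∈ arcs π) ∨ ∃ l, b < l ∧ (a, l) ∈ arcs π) := by
  refine and_congr_right fun h => ?_
  change ¬(a < b ∧ _ ∧ _) ↔ _
  rw [and_iff_right h, not_and_or, not_not, not_not]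

open Classical in
/-- The parameters at the singular pairs can be recovered from the functional, starting from the
upper right corner. -/
theorem eq_of_arcFunctional_param_eq {φ : arcs π → Kˣ} {x y : Fin n → Fin n → K}
    (e : arcFunctional π φ (rowParam π x) (colParam π x) =
      arcFunctional π φ (rowParam π y) (colParam π y)) :
    ∀ (d : ℕ) (a b : Fin n), (a, b) ∈ singularPairs π → n - ((b : ℕ) - a) ≤ d →
      x a b = y a b := by
  intro d
  induction d with
  | zero =>
    intro a b hs hd
    have := hs.1
    dsimp only at this
    rw [Fin.lt_def] at this
    omega
  | succ d ih =>
    intro a b hs hd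
    have hab : a < b := hs.1
    have hab' : (a : ℕ) < b := hab
    have h := LinearMap.congr_fun e (upperUnit K hab)
    rw [arcFunctional_upperUnit, arcFunctional_upperUnit, ← sub_eq_zero,
      ← Finset.sum_sub_distrib] at h
    -- An arc strictly enclosing `(a, b)` contributes only parameters at `(a, j)` and `(i, b)`, both
    -- on longer diagonals and known by induction. Only an arc ending at `b` or starting at `a` can
    -- involve `x a b`.
    have hfar : ∀ i j : Fin n, (i, j) ∈ arcs π → ¬(i = a ∧ b < j) → ¬(i < a ∧ j = b) →
        uniMatrix (rowParam π x) i a * uniMatrix (colParam π x) b j =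
          uniMatrix (rowParam π y) i a * uniMatrix (colParam π y) b j := by
      intro i j hp h1 h2
      rcases lt_or_ge a i with hi | hi
      · rw [uniMatrix_lower _ hi, uniMatrix_lower _ hi, zero_mul, zero_mul]
      rcases lt_or_ge j b with hj | hj
      · rw [uniMatrix_lower _ hj, uniMatrix_lower _ hj, mul_zero, mul_zero]
      rcases hi.eq_or_lt with rfl | hi
      · rcases hj.eq_or_lt with rfl | hj
        · exact absurd (arcs_subset_regularPairs hp) hs.2
        · exact absurd ⟨rfl, hj⟩ h1
      rcases hj.eq_or_lt with rfl | hj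
      · exact absurd ⟨hi, rfl⟩ h2
      have hi' : (i : ℕ) < a := hi
      have hj' : (b : ℕ) < j := hj
      rw [rowParam_apply x hp hi (hab.trans hj), rowParam_apply y hp hi (hab.trans hj),
        colParam_apply x hp (hi.trans hab) hj, colParam_apply y hp (hi.trans hab) hj,
        ih a j (mem_singularPairs_iff.2 ⟨hab.trans hj, .inl ⟨i, hi, hp⟩⟩) (by omega),
        ih i b (mem_singularPairs_iff.2 ⟨hi.trans hab, .inr ⟨j, hj, hp⟩⟩) (by omega)]
    by_cases hbelow : ∃ k, k < a ∧ (k, b) ∈ arcs π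
    · obtain ⟨k, hka, hk⟩ := id hbelow
      rw [Finset.sum_eq_single ⟨(k, b), hk⟩, ← mul_sub] at h
      · simp only [uniMatrix_diag, mul_one, rowParam_apply x hk hka hab,
          rowParam_apply y hk hka hab] at h
        exact sub_eq_zero.1 ((mul_eq_zero.1 h).resolve_left (Units.ne_zero _))
      · rintro ⟨⟨i, j⟩, hp⟩ _ hne
        rw [← mul_sub, sub_eq_zero.2, mul_zero]
        dsimp only
        by_cases h1 : i = a ∧ b < j
        -- When arcs `(k, b)` and `(a, j)` cross, both could carry `x a b`; `colParam` vanishes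
        -- there, so it enters once, through the row.
        · obtain ⟨rfl, hj⟩ := h1
          rw [colParam_apply x hp hab hj, colParam_apply y hp hab hj, if_pos hbelow, if_pos hbelow,
            mul_zero, mul_zero]
        · refine hfar i j hp h1 ?_
          rintro ⟨_, rfl⟩
          obtain rfl := arcs_left_unique hp hk
          exact hne rfl
      · simp
    · obtain ⟨l, hbl, hl⟩ := ((mem_singularPairs_iff.1 hs).2).resolve_left hbelow
      rw [Finset.sum_eq_single ⟨(a, l), hl⟩, ← mul_sub] at h
      · simp only [uniMatrix_diag, one_mul, colParam_apply x hl hab hbl,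
          colParam_apply y hl hab hbl, if_neg hbelow] at h
        exact sub_eq_zero.1 ((mul_eq_zero.1 h).resolve_left (Units.ne_zero _))
      · rintro ⟨⟨i, j⟩, hp⟩ _ hne
        rw [← mul_sub, sub_eq_zero.2, mul_zero]
        refine hfar i j hp ?_ ?_
        · rintro ⟨rfl, _⟩
          obtain rfl := arcs_right_unique hp hl
          exact hne rfl
        · rintro ⟨hi, rfl⟩
          exact hbelow ⟨i, hi, hp⟩
      · simp

/-- Only one arc starts at `i`, so evaluating at the unit `(i, b)` isolates the entry at `(b, j)` up
to a nonzero colour. The criterion does not involve `φ`, whence `card_rightOrbit_eq`. -/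
theorem arcFunctional_one_left_eq_iff (φ : arcs π → Kˣ) (h h' : unitriangular n K) :
    arcFunctional π φ 1 h = arcFunctional π φ 1 h' ↔
      ∀ i j, (i, j) ∈ arcs π → ∀ b, i < b → uniMatrix h b j = uniMatrix h' b j := by
  classical
  constructor
  · intro e i j hp b hb
    have key : ∀ h : unitriangular n K, arcFunctional π φ 1 h (upperUnit K hb) =
        φ ⟨(i, j), hp⟩ * uniMatrix h b j := by
      intro h
      rw [arcFunctional_upperUnit, Finset.sum_eq_single ⟨(i, j), hp⟩]
      · rw [uniMatrix_diag, one_mul]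
      · rintro ⟨⟨k, l⟩, hp'⟩ _ hne
        rw [uniMatrix_one, Matrix.one_apply_ne, zero_mul, mul_zero]
        rintro h
        dsimp only at h
        subst h
        obtain rfl := arcs_right_unique hp hp'
        exact hne rfl
      · simp
    have := LinearMap.congr_fun e (upperUnit K hb)
    rw [key, key] at this
    exact mul_left_cancel₀ (Units.ne_zero _) this
  · intro e
    refine LinearMap.ext fun x => Finset.sum_congr rfl fun p _ => ?_
    rw [uniMatrix_one, Matrix.one_mul, Matrix.mul_apply, Matrix.mul_apply]
    congr 1
    refine Finset.sum_congr rfl fun b _ => ?_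
    rcases lt_or_ge p.1.1 b with hb | hb
    · rw [e p.1.1 p.1.2 p.2 b hb]
    · rw [x.2 _ _ hb, zero_mul, zero_mul]

theorem natCard_dual : Nat.card (Module.Dual K (strictlyUpper n K)) =
    Nat.card (unitriangular n K) := by
  rw [Nat.card_eq_of_bijective _ (uniSubOne_bijective (n := n) (K := K)),
    Module.natCard_eq_pow_finrank (K := K) (V := Module.Dual K (strictlyUpper n K)),
    Module.natCard_eq_pow_finrank (K := K) (V := strictlyUpper n K), Subspace.dual_finrank_eq]

/-! ### Exact orbit sizes by counting -/

variable [Finite K]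

open Classical in
theorem card_singular_le_card_twoSidedOrbit (φ : arcs π → Kˣ) :
    Nat.card (singularPairs π → K) ≤ (twoSidedOrbit π φ).card := by
  -- The default `0` is immaterial: `rowParam` and `colParam` only use values at singular pairs.
  let ext (x : singularPairs π → K) (a b : Fin n) : K :=
    if h : (a, b) ∈ singularPairs π then x ⟨_, h⟩ else 0
  let f (x : singularPairs π → K) : twoSidedOrbit π φ :=
    ⟨arcFunctional π φ (rowParam π (ext x)) (colParam π (ext x)),
      Finset.mem_image.2 ⟨(_, _), Finset.mem_univ _, rfl⟩⟩
  have hf : Function.Injective f := by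
    intro x y hxy
    have := eq_of_arcFunctional_param_eq (congrArg Subtype.val hxy)
    funext ⟨⟨a, b⟩, hs⟩
    have := this _ a b hs le_rfl
    simpa only [ext, dif_pos hs] using this
  simpa using Nat.card_le_card_of_injective f hf

instance : Finite (Module.Dual K (strictlyUpper n K)) := Module.finite_of_finite K

theorem disjoint_twoSidedOrbit
    {c c' : Σ π : Finpartition (Finset.univ : Finset (Fin n)), arcs π → Kˣ} (hne : c ≠ c') :
    Disjoint (twoSidedOrbit c.1 c.2) (twoSidedOrbit c'.1 c'.2) := by
  rw [Finset.disjoint_left]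
  intro μ h h'
  apply hne
  obtain ⟨π, φ⟩ := c
  obtain ⟨π', φ'⟩ := c'
  simp only [twoSidedOrbit, Finset.mem_image] at h h'
  obtain ⟨⟨u, v⟩, -, rfl⟩ := h
  obtain ⟨⟨u', v'⟩, -, h⟩ := h'
  obtain ⟨h1, h2⟩ := arcs_eq_of_arcFunctional_eq h.symm
  obtain rfl := arcs_injective h1
  congr
  funext p
  exact h2 p.1 p.2 p.2

open Classical in
theorem natCard_unitriangular_eq_sum :
    Nat.card (unitriangular n K) =
      ∑ π : Finpartition (Finset.univ : Finset (Fin n)), Nat.card (Jset K π) := by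
  rw [← Nat.card_congr (Equiv.sigmaFiberEquiv (readPartition : unitriangular n K → _)),
    Nat.card_sigma]
  refine Finset.sum_congr rfl fun π _ => Nat.card_congr (Equiv.subtypeEquivRight fun A => ?_)
  exact mem_Jset_iff_readPartition.symm

/-- A squeeze: the lower bounds for all coloured partitions sum to the number of matrices in all
`J_π`, which is the size of the whole dual, so no orbit can exceed its bound. -/
theorem card_twoSidedOrbit (φ : arcs π → Kˣ) :
    (twoSidedOrbit π φ).card = Nat.card (singularPairs π → K) := by
  classical
  have := Fintype.ofFinite K
  have := Fintype.ofFinite (Module.Dual K (strictlyUpper n K))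
  let C := Σ π : Finpartition (Finset.univ : Finset (Fin n)), arcs π → Kˣ
  have hle : ∀ c ∈ (Finset.univ : Finset C),
      Nat.card (singularPairs c.1 → K) ≤ (twoSidedOrbit c.1 c.2).card :=
    fun c _ => card_singular_le_card_twoSidedOrbit c.2
  have hsum : ∑ c : C, (twoSidedOrbit c.1 c.2).card ≤ Nat.card (unitriangular n K) := by
    rw [← natCard_dual, ← Finset.card_biUnion fun c _ c' _ h => disjoint_twoSidedOrbit h,
      Nat.card_eq_fintype_card]
    exact Finset.card_le_univ _
  have hcount : Nat.card (unitriangular n K) = ∑ c : C, Nat.card (singularPairs c.1 → K) := by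
    rw [natCard_unitriangular_eq_sum, Fintype.sum_sigma]
    refine Finset.sum_congr rfl fun π _ => ?_
    rw [Nat.card_congr (JsetEquiv K π), Nat.card_prod]
    simp
  have heq := (Finset.sum_eq_sum_iff_of_le hle).1
    (le_antisymm (Finset.sum_le_sum hle) (hsum.trans hcount.le))
  exact (heq ⟨π, φ⟩ (Finset.mem_univ _)).symm

theorem card_image_le_of_factorsThrough {α β γ : Type*} [DecidableEq β] [DecidableEq γ]
    [Nonempty γ] {f : α → β} {g : α → γ} (h : g.FactorsThrough f) (s : Finset α) :
    (s.image g).card ≤ (s.image f).card := by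
  have : s.image g = (s.image f).image (Function.extend f g fun _ => Classical.arbitrary γ) := by
    rw [Finset.image_image]
    exact Finset.image_congr fun a _ => (h.extend_apply _ a).symm
  rw [this]
  exact Finset.card_image_le

theorem card_rightOrbit_eq (φ φ' : arcs π → Kˣ) :
    (rightOrbit π φ).card = (rightOrbit π φ').card := by
  classical
  have key : ∀ φ φ' : arcs π → Kˣ, (rightOrbit π φ).card ≤ (rightOrbit π φ').card := by
    intro φ φ'
    refine card_image_le_of_factorsThrough (fun h h' e => ?_) _
    rwa [arcFunctional_one_left_eq_iff] at e ⊢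
  exact le_antisymm (key _ _) (key _ _)

end Orbits

/-! ### Orthogonality and the superplancherel measure -/

section SuperPlancherel

variable {n : ℕ} {K : Type*} [Field K] [Finite K]

/-- The characters attached to distinct functionals are orthogonal. -/
theorem sum_addChar_mul_conj {ψ : AddChar K ℂ} (hψ : ψ ≠ 1)
    (μ ν : Module.Dual K (strictlyUpper n K)) [Decidable (μ = ν)] :
    ∑ g : unitriangular n K, ψ (μ (uniSubOne g)) * (starRingEnd ℂ) (ψ (ν (uniSubOne g))) =
      if μ = ν then (Nat.card (unitriangular n K) : ℂ) else 0 := by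
  have := Fintype.ofFinite (strictlyUpper n K)
  let χ : AddChar (strictlyUpper n K) ℂ := ψ.compAddMonoidHom (μ - ν).toAddMonoidHom
  have hχ : ∀ g : unitriangular n K,
      ψ (μ (uniSubOne g)) * (starRingEnd ℂ) (ψ (ν (uniSubOne g))) = χ (uniSubOne g) := by
    intro g
    rw [← AddChar.map_neg_eq_conj, ← AddChar.map_add_eq_mul, ← sub_eq_add_neg]
    rfl
  simp only [hχ]
  split_ifs with h
  · subst h
    have h1 : ∀ x, χ x = 1 := fun x => by simp [χ]
    simp [h1, Nat.card_eq_fintype_card]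
  · rw [uniSubOne_bijective.sum_comp fun x => χ x]
    -- The nonzero functional `μ - ν` is onto `K`, so triviality of `χ` would force `ψ` to be
    -- trivial.
    refine AddChar.sum_eq_zero_of_ne_one fun hone => hψ ?_
    ext t
    obtain ⟨x, hx⟩ : ∃ x, (μ - ν) x = t :=
      LinearMap.surjective (sub_ne_zero.2 h) t
    rw [← hx]
    exact DFunLike.congr_fun hone x

/-- The superplancherel measure of a multiple of the sum of the characters attached to a set of
functionals. -/
theorem superPlancherel_of_eq_sum {ψ : AddChar K ℂ} (hψ : ψ ≠ 1) {c : ℂ} (hc : c ≠ 0)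
    (hcc : (starRingEnd ℂ) c = c) (T : Finset (Module.Dual K (strictlyUpper n K)))
    {χ : unitriangular n K → ℂ} (hχ : ∀ g, χ g = c * ∑ μ ∈ T, ψ (μ (uniSubOne g))) :
    superPlancherel χ = (T.card : ℂ) / (Nat.card (unitriangular n K) : ℂ) := by
  classical
  have hone : χ 1 = c * T.card := by simp [hχ, uniSubOne_one]
  have hU : (Nat.card (unitriangular n K) : ℂ) ≠ 0 := by
    simp [Nat.card_eq_fintype_card, Fintype.card_ne_zero]
  have hinner : charInner χ χ = c ^ 2 * T.card := by
    have : ∑ g, χ g * (starRingEnd ℂ) (χ g) =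
        c ^ 2 * (T.card * (Nat.card (unitriangular n K) : ℂ)) := by
      calc ∑ g, χ g * (starRingEnd ℂ) (χ g)
          = ∑ g, c ^ 2 * ∑ μ ∈ T, ∑ ν ∈ T,
              ψ (μ (uniSubOne g)) * (starRingEnd ℂ) (ψ (ν (uniSubOne g))) := by
            refine Finset.sum_congr rfl fun g _ => ?_
            rw [hχ, map_mul, hcc, map_sum, ← Finset.sum_mul_sum]
            ring
        _ = c ^ 2 * ∑ μ ∈ T, ∑ ν ∈ T, ∑ g : unitriangular n K,
              ψ (μ (uniSubOne g)) * (starRingEnd ℂ) (ψ (ν (uniSubOne g))) := by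
            rw [← Finset.mul_sum, Finset.sum_comm]
            congr 1
            exact Finset.sum_congr rfl fun μ _ => Finset.sum_comm
        _ = _ := by
            simp only [sum_addChar_mul_conj hψ]
            simp
    rw [charInner, this]
    field_simp
  rw [superPlancherel, hone, hinner]
  -- For empty `T` both sides are `0`, as division by zero gives `0`.
  rcases eq_or_ne (T.card : ℂ) 0 with h | h
  · simp [h]
  · field_simp

open Classical in
theorem rightOrbit_nonempty {π : Finpartition (Finset.univ : Finset (Fin n))}
    (φ : arcs π → Kˣ) : (rightOrbit π φ).Nonempty :=
  Finset.univ_nonempty.image _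

/-- Neither orbit size depends on the colouring, so the coloured supercharacters share one
coefficient, computed below from the constant colouring `1`. -/
theorem superPlancherel_supercharacter {ψ : AddChar K ℂ} (hψ : ψ ≠ 1)
    (π : Finpartition (Finset.univ : Finset (Fin n))) :
    superPlancherel (supercharacter (K := K) ψ π) =
      (Nat.card (Jset K π) : ℂ) / (Nat.card (unitriangular n K) : ℂ) := by
  classical
  have := Fintype.ofFinite K
  have hdisj : ((Finset.univ : Finset (arcs π → Kˣ)) : Set (arcs π → Kˣ)).PairwiseDisjoint
      fun φ => twoSidedOrbit π φ := fun φ _ φ' _ h =>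
    disjoint_twoSidedOrbit (c := ⟨π, φ⟩) (c' := ⟨π, φ'⟩) (by simpa using h)
  let T : Finset (Module.Dual K (strictlyUpper n K)) :=
    Finset.univ.disjiUnion (fun φ : arcs π → Kˣ => twoSidedOrbit π φ) hdisj
  have hT : T.card = Nat.card (Jset K π) := by
    rw [show T = Finset.univ.disjiUnion _ _ from rfl, Finset.card_disjiUnion, Nat.card_congr (JsetEquiv K π),
      Nat.card_prod]
    simp [card_twoSidedOrbit]
  rw [← hT]
  refine superPlancherel_of_eq_sum hψ
    (c := ((rightOrbit π fun _ => (1 : Kˣ)).card : ℂ) / (Nat.card (singularPairs π → K) : ℂ))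
    (div_ne_zero ?_ ?_) (by simp) T fun g => ?_
  · rw [Nat.cast_ne_zero, Finset.card_ne_zero]
    exact rightOrbit_nonempty _
  · exact Nat.cast_ne_zero.2 Nat.card_pos.ne'
  · rw [supercharacter, finsum_eq_sum_of_fintype,
      show T = Finset.univ.disjiUnion _ _ from rfl, Finset.sum_disjiUnion, Finset.mul_sum]
    refine Finset.sum_congr rfl fun φ _ => ?_
    rw [colouredSupercharacter, card_rightOrbit_eq φ fun _ => 1, card_twoSidedOrbit]

theorem toReal_uniformOfFintype_toOuterMeasure {α : Type*} [Fintype α] [Nonempty α]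
    (s : Set α) : ((PMF.uniformOfFintype α).toOuterMeasure s).toReal =
      (Nat.card s : ℝ) / (Nat.card α : ℝ) := by
  classical
  have := Fintype.ofFinite s
  rw [PMF.toOuterMeasure_uniformOfFintype_apply, ENNReal.toReal_div, Nat.card_eq_fintype_card,
    Nat.card_eq_fintype_card, ENNReal.toReal_natCast, ENNReal.toReal_natCast]

end SuperPlancherel

theorem mainTheorem12 (n : ℕ) (K : Type*) [Field K] [Finite K]
    (ψ : AddChar K ℂ) (hψ : ψ ≠ 1) :
    -- the sets `J_π` are pairwise distinct and form a partition of `U_n(K)`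
    (Function.Injective
        (Jset K : Finpartition (Finset.univ : Finset (Fin n)) → Set (unitriangular n K)) ∧
      Setoid.IsPartition (Set.range
        (Jset K : Finpartition (Finset.univ : Finset (Fin n)) → Set (unitriangular n K)))) ∧
    -- the superplancherel measure of `π` is the proportion of `U_n(K)` lying in `J_π`
    (∀ π : Finpartition (Finset.univ : Finset (Fin n)),
      superPlancherel (supercharacter (K := K) ψ π) =
        (Nat.card (Jset K π) : ℂ) / (Nat.card (unitriangular n K) : ℂ)) ∧
    -- equivalently, the probability that a uniform random matrix in `U_n(K)` lies in `J_π`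
    (∀ π : Finpartition (Finset.univ : Finset (Fin n)),
      superPlancherel (supercharacter (K := K) ψ π) =
        (((PMF.uniformOfFintype (unitriangular n K)).toOuterMeasure (Jset K π)).toReal : ℂ)) ∧
    -- the algorithm reduces `A` to the canonical matrix of the `π` with `A ∈ J_π`, and the arcs
    -- of `π` are read off from the nonzero entries of the output
    (∀ A : unitriangular n K,
      A ∈ Jset K (readPartition A) ∧
      reduceMatrix A = canonicalMatrix K (readPartition A) ∧
      arcs (readPartition A) = {p | p.1 < p.2 ∧ reduceMatrix A p.1 p.2 ≠ 0}) ∧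
    -- run on a uniform random matrix, it samples from the superplancherel measure
    (∀ π : Finpartition (Finset.univ : Finset (Fin n)),
      ((((PMF.uniformOfFintype (unitriangular n K)).map readPartition) π).toReal : ℂ) =
        superPlancherel (supercharacter (K := K) ψ π)) := by
  have huniform : ∀ π : Finpartition (Finset.univ : Finset (Fin n)),
      superPlancherel (supercharacter (K := K) ψ π) =
        (((PMF.uniformOfFintype (unitriangular n K)).toOuterMeasure (Jset K π)).toReal : ℂ) := by
    intro π
    rw [superPlancherel_supercharacter hψ, toReal_uniformOfFintype_toOuterMeasure]
    push_cast
    rfl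
  refine ⟨⟨Jset_injective, isPartition_range_Jset⟩, superPlancherel_supercharacter hψ, huniform,
    fun A => ⟨mem_Jset_readPartition A, reduceMatrix_eq_canonicalMatrix A, arcs_readPartition A⟩,
    fun π => ?_⟩
  rw [huniform, ← PMF.toOuterMeasure_apply_singleton, PMF.toOuterMeasure_map_apply]
  have : readPartition ⁻¹' {π} = Jset K π := Set.ext fun A => mem_Jset_iff_readPartition.symm
  rw [this]
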